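/- **Setting.** Consider a zero-sum stochastic game with horizon $T$ between two teams, Team $i\in\{1,2\}$ having players $j=1,\dots,N_i$; Team 1 minimizes and Team 2 maximizes. All sets of values below are finite, and the action sets are nonempty. The state $X_t$, the actions $U_t=(U_t^{i,j})_{i,j}$ and the observations $Y_t=(Y_t^{i,j})_{i,j}$ satisfy $X_{t+1}=f_t(X_t,U_t,W_t^s)$, $Y_1^{i,j}=h_1^{i,j}(X_1,W_1^{i,j})$ and $Y_{t+1}^{i,j}=h_{t+1}^{i,j}(X_{t+1},U_t,W_{t+1}^{i,j})$, where the initial state and all the noise variables $X_1,W_t^s,W_t^{i,j}$ are mutually independent and finitely valued. The common information is $C_t=(Z_1,\dots,Z_t)$ and player $j$ of Team $i$ has the private information $P_t^{i,j}$; with $P_t=(P_t^{i,j})_{i,j}$, they are given by fixed maps, $Z_1=\zeta_1(Y_1)$, $P_1=\xi_1(Y_1)$, $Z_{t+1}=\zeta_{t+1}(P_t,U_t,Y_{t+1})$ and $P_{t+1}=\xi_{t+1}(P_t,U_t,Y_{t+1})$. The cost at time $t$ is $c_t(X_t,U_t)\in\mathbb R$. In the *expanded game* $G_e$ each team is replaced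 by a virtual player. At each time $t\le T$ virtual player $i$ chooses a prescription $\Gamma_t^i=(\Gamma_t^{i,j})_j\in\mathcal B_t^i$, where $\Gamma_t^{i,j}$ maps the realizations of $P_t^{i,j}$ to probability distributions on the action set of player $j$ of Team $i$. The choice is $\Gamma_t^i=\tilde\chi_t^i(C_t,\Gamma^1_{1:t-1},\Gamma^2_{1:t-1})$ for a strategy $\tilde\chi^i=(\tilde\chi^i_1,\dots,\tilde\chi^i_T)$. Then the actions $U_t^{i,j}$ are drawn independently of each other from the distributions $\Gamma_t^{i,j}(P_t^{i,j})$. With $\mathcal J(\tilde\chi^1,\tilde\chi^2)=\mathbb E\big[\sum_{t=1}^T c_t(X_t,U_t)\big]$, the upper and lower values are $$S^u(G_e)=\min_{\tilde\chi^1}\sup_{\tilde\chi^2}\mathcal J(\tilde\chi^1,\tilde\chi^2),\qquad S^l(G_e)=\max_{\tilde\chi^2}\inf_{\tilde\chi^1}\mathcal J(\tilde\chi^1,\tilde\chi^2).$$ For a belief $\pi$ (a probability distribution on the values of $(X_t,P_t)$) and prescriptions $\gamma^1\in\mathcal B^1_t$, $\gamma^2\in\mathcal B_t^2$, let $\gamma^i(p^i;u^i)=\prod_j\gamma^{i,j}(p^{i,j})(u^{i,j})$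 and $$\tilde c_t(\pi,\gamma^1,\gamma^2)=\sum_{x,p,u}c_t(x,u)\,\pi(x,p)\,\gamma^1(p^1;u^1)\,\gamma^2(p^2;u^2),$$ $$\mathscr P^j_t(\pi,\gamma^1,\gamma^2;z',x',p')=\sum_{x,p,u}\pi(x,p)\,\gamma^1(p^1;u^1)\,\gamma^2(p^2;u^2)\,\mathbb P[X_{t+1}=x',P_{t+1}=p',Z_{t+1}=z'\mid X_t=x,P_t=p,U_t=u],$$ $$\mathscr P^m_t(\pi,\gamma^1,\gamma^2;z')=\sum_{x',p'}\mathscr P^j_t(\pi,\gamma^1,\gamma^2;z',x',p').$$ Let $F_t(\pi,\gamma^1,\gamma^2,z')$ be the belief $\mathscr P_t^j(\pi,\gamma^1,\gamma^2;z',\cdot,\cdot)/\mathscr P_t^m(\pi,\gamma^1,\gamma^2;z')$ if $\mathscr P_t^m(\pi,\gamma^1,\gamma^2;z')>0$, and any belief (chosen as an arbitrary function of the arguments) otherwise. Put $V^u_{T+1}=V^l_{T+1}=0$ and, for $t=T,\dots,1$ and $a\in\{u,l\}$, $$w_t^a(\pi,\gamma^1,\gamma^2)=\tilde c_t(\pi,\gamma^1,\gamma^2)+\sum_{z'}\mathscr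 P_t^m(\pi,\gamma^1,\gamma^2;z')\,V^a_{t+1}\big(F_t(\pi,\gamma^1,\gamma^2,z')\big),$$ $$V_t^u(\pi)=\min_{\gamma^1}\max_{\gamma^2}w_t^u(\pi,\gamma^1,\gamma^2),\qquad V_t^l(\pi)=\max_{\gamma^2}\min_{\gamma^1}w_t^l(\pi,\gamma^1,\gamma^2).$$ **Theorem.** The minima and maxima in the definitions of $V_t^u$, $V_t^l$, $S^u(G_e)$ and $S^l(G_e)$ exist, the supremum and the infimum in the latter two are finite, and $$S^u(G_e)=\mathbb E[V_1^u(\Pi_1)],\qquad S^l(G_e)=\mathbb E[V_1^l(\Pi_1)],$$ where $\Pi_1$ is the conditional distribution of $(X_1,P_1)$ given $C_1$. -/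

import Mathlib

/-! Finite-horizon stochastic zero-sum games between two teams, the associated expanded game
played by two virtual players, and the two dynamic programs on the common information belief. -/

noncomputable section

/-- A zero-sum stochastic game between two teams.

Team `0` minimizes and team `1` maximizes; team `i` has the players `j : Fin (N i)`.
Time starts at `0`, so the decision times are `0, …, T - 1`; data at later times is never used.
All sets are finite, and every noise variable is given by its distribution: the initial state and
all the noise variables are independent.  `P t i j` is the set of realizations of the private
information of player `j` of team `i`, and `Z t` is the set of realizations of the increment of the
common information, so that the common information at time `t` is the sequence `z 0, …, z t`.
Both are computed from the past, through `xi` and `zeta`. -/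
structure TeamGame where
  /-- horizon -/
  T : ℕ
  /-- number of players of each team -/
  N : Fin 2 → ℕ
  /-- states -/
  X : ℕ → Type
  /-- actions -/
  U : ℕ → (i : Fin 2) → Fin (N i) → Type
  /-- observations -/
  Y : ℕ → (i : Fin 2) → Fin (N i) → Type
  /-- private information -/
  P : ℕ → (i : Fin 2) → Fin (N i) → Type
  /-- increments of the common information -/
  Z : ℕ → Type
  /-- values of the system noise -/
  Ws : ℕ → Type
  /-- values of the observation noise -/
  Wo : ℕ → (i : Fin 2) → Fin (N i) → Type
  [fintypeX : ∀ t, Fintype (X t)]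
  [fintypeU : ∀ t i j, Fintype (U t i j)]
  [fintypeY : ∀ t i j, Fintype (Y t i j)]
  [fintypeP : ∀ t i j, Fintype (P t i j)]
  [fintypeZ : ∀ t, Fintype (Z t)]
  [fintypeWs : ∀ t, Fintype (Ws t)]
  [fintypeWo : ∀ t i j, Fintype (Wo t i j)]
  [nonemptyU : ∀ t i j, Nonempty (U t i j)]
  /-- distribution of the initial state -/
  lawX : stdSimplex ℝ (X 0)
  /-- distribution of the system noise -/
  lawWs : ∀ t, stdSimplex ℝ (Ws t)
  /-- distribution of the observation noise -/
  lawWo : ∀ t i j, stdSimplex ℝ (Wo t i j)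
  /-- state dynamics -/
  f : ∀ t, X t → (∀ i j, U t i j) → Ws t → X (t + 1)
  /-- initial observations -/
  h₀ : ∀ i j, X 0 → Wo 0 i j → Y 0 i j
  /-- later observations, which may depend on the preceding actions -/
  h : ∀ t i j, X (t + 1) → (∀ i j, U t i j) → Wo (t + 1) i j → Y (t + 1) i j
  /-- initial common information -/
  zeta₀ : (∀ i j, Y 0 i j) → Z 0
  /-- increment of the common information -/
  zeta : ∀ t, (∀ i j, P t i j) → (∀ i j, U t i j) → (∀ i j, Y (t + 1) i j) → Z (t + 1)
  /-- initial private information -/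
  xi₀ : (∀ i j, Y 0 i j) → ∀ i j, P 0 i j
  /-- evolution of the private information -/
  xi : ∀ t, (∀ i j, P t i j) → (∀ i j, U t i j) → (∀ i j, Y (t + 1) i j) → ∀ i j, P (t + 1) i j
  /-- cost -/
  c : ∀ t, X t → (∀ i j, U t i j) → ℝ

namespace TeamGame

attribute [instance] fintypeX fintypeU fintypeY fintypeP fintypeZ fintypeWs fintypeWo nonemptyU

variable (G : TeamGame)

/-- Joint actions of all the players of both teams. -/
abbrev Act (t : ℕ) : Type := ∀ i j, G.U t i j

/-- Joint private information of all the players of both teams. -/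
abbrev Priv (t : ℕ) : Type := ∀ i j, G.P t i j

/-- Prescriptions of virtual player `i`: for each player of the team, a map from the private
information to distributions over the actions. -/
abbrev Presc (t : ℕ) (i : Fin 2) : Type :=
  ∀ j : Fin (G.N i), G.P t i j → stdSimplex ℝ (G.U t i j)

/-- Beliefs on the state and the private information. -/
abbrev Belief (t : ℕ) : Type := stdSimplex ℝ (G.X t × G.Priv t)

variable {G} in
/-- The probability of the team action `u` under a prescription when the private information of
the team is `p`: the players of a team randomize independently. -/
def actProb {t : ℕ} {i : Fin 2} (γ : G.Presc t i) (p : ∀ j, G.P t i j) (u : ∀ j, G.U t i j) : ℝ :=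
  ∏ j, γ j (p j) (u j)

open Classical in
/-- `ℙ[x₀, p₀, z₀]`, the joint law of the initial state, private and common information. -/
def initProb (x : G.X 0) (p : G.Priv 0) (z : G.Z 0) : ℝ :=
  ∑ w : ∀ i j, G.Wo 0 i j,
    let y : ∀ i j, G.Y 0 i j := fun i j => G.h₀ i j x (w i j)
    if G.xi₀ y = p ∧ G.zeta₀ y = z then G.lawX x * ∏ i, ∏ j, G.lawWo 0 i j (w i j) else 0

open Classical in
/-- `ℙ[xₜ₊₁, pₜ₊₁, zₜ₊₁ ∣ xₜ, pₜ, uₜ]`. -/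
def transProb (t : ℕ) (x : G.X t) (p : G.Priv t) (u : G.Act t)
    (x' : G.X (t + 1)) (p' : G.Priv (t + 1)) (z' : G.Z (t + 1)) : ℝ :=
  ∑ ws : G.Ws t, ∑ w : ∀ i j, G.Wo (t + 1) i j,
    let y : ∀ i j, G.Y (t + 1) i j := fun i j => G.h t i j (G.f t x u ws) u (w i j)
    if G.f t x u ws = x' ∧ G.xi t p u y = p' ∧ G.zeta t p u y = z' then
      G.lawWs t ws * ∏ i, ∏ j, G.lawWo (t + 1) i j (w i j)
    else 0

/-! ### The expanded game -/

/-- The information of the virtual players at time `t`: the common information and all the past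
prescriptions of both of them. -/
def Info : ℕ → Type
  | 0 => G.Z 0
  | t + 1 => Info t × (G.Presc t 0 × G.Presc t 1) × G.Z (t + 1)

/-- Strategies of virtual player `i` in the expanded game (the control laws at times `t ≥ T` play
no role). -/
abbrev Strat (i : Fin 2) : Type := ∀ t, G.Info t → G.Presc t i

/-- Realizations of all the states, private information, common information and actions
up to time `t` (for the actions: up to time `t - 1`). -/
def Traj : ℕ → Type
  | 0 => G.X 0 × G.Priv 0 × G.Z 0
  | t + 1 => Traj t × G.Act t × G.X (t + 1) × G.Priv (t + 1) × G.Z (t + 1)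

instance fintypeTraj : ∀ t, Fintype (G.Traj t)
  | 0 => inferInstanceAs (Fintype (G.X 0 × G.Priv 0 × G.Z 0))
  | t + 1 =>
    letI := fintypeTraj t
    inferInstanceAs
      (Fintype (G.Traj t × G.Act t × G.X (t + 1) × G.Priv (t + 1) × G.Z (t + 1)))

/-- The state at time `t`. -/
def Traj.state : ∀ t, G.Traj t → G.X t
  | 0, (x, _, _) => x
  | _ + 1, (_, _, x, _, _) => x

/-- The private information at time `t`. -/
def Traj.priv : ∀ t, G.Traj t → G.Priv t
  | 0, (_, p, _) => p
  | _ + 1, (_, _, _, p, _) => p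

/-- The information of the virtual players at time `t`, if they use the strategies `χ₁` and `χ₂`. -/
def Traj.info (χ₁ : G.Strat 0) (χ₂ : G.Strat 1) : ∀ t, G.Traj t → G.Info t
  | 0, (_, _, z) => z
  | t + 1, (ω, _, _, _, z) =>
    let ι := Traj.info χ₁ χ₂ t ω
    (ι, (χ₁ t ι, χ₂ t ι), z)

/-- The probability of a trajectory of the expanded game under the strategies `χ₁` and `χ₂`. -/
def trajProb (χ₁ : G.Strat 0) (χ₂ : G.Strat 1) : ∀ t, G.Traj t → ℝ
  | 0, (x, p, z) => G.initProb x p z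
  | t + 1, (ω, u, x', p', z') =>
    let ι := Traj.info G χ₁ χ₂ t ω
    let x := Traj.state G t ω
    let p := Traj.priv G t ω
    trajProb χ₁ χ₂ t ω * (actProb (χ₁ t ι) (p 0) (u 0) * actProb (χ₂ t ι) (p 1) (u 1)) *
      G.transProb t x p u x' p' z'

/-- The total cost at the times `0, …, t - 1`. -/
def totalCost : ∀ t, G.Traj t → ℝ
  | 0, _ => 0
  | t + 1, (ω, u, _, _, _) => totalCost t ω + G.c t (Traj.state G t ω) u

/-- The total expected cost in the expanded game. -/
def expectedCost (χ₁ : G.Strat 0) (χ₂ : G.Strat 1) : ℝ :=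
  ∑ ω : G.Traj G.T, G.trajProb χ₁ χ₂ G.T ω * G.totalCost G.T ω

/-- The upper value of the expanded game. -/
def upperValue : ℝ := ⨅ χ₁ : G.Strat 0, ⨆ χ₂ : G.Strat 1, G.expectedCost χ₁ χ₂

/-- The lower value of the expanded game. -/
def lowerValue : ℝ := ⨆ χ₂ : G.Strat 1, ⨅ χ₁ : G.Strat 0, G.expectedCost χ₁ χ₂

/-! ### The common information belief -/

lemma actProb_nonneg {t : ℕ} {i : Fin 2} (γ : G.Presc t i) (p : ∀ j, G.P t i j)
    (u : ∀ j, G.U t i j) : 0 ≤ actProb γ p u :=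
  Finset.prod_nonneg fun j _ => (γ j (p j)).2.1 (u j)

lemma initProb_nonneg (x : G.X 0) (p : G.Priv 0) (z : G.Z 0) : 0 ≤ G.initProb x p z := by
  refine Finset.sum_nonneg fun w _ => ?_
  dsimp only
  split_ifs
  · exact mul_nonneg (G.lawX.2.1 x) (Finset.prod_nonneg fun i _ => Finset.prod_nonneg fun j _ =>
      (G.lawWo 0 i j).2.1 (w i j))
  · exact le_rfl

lemma transProb_nonneg (t : ℕ) (x : G.X t) (p : G.Priv t) (u : G.Act t)
    (x' : G.X (t + 1)) (p' : G.Priv (t + 1)) (z' : G.Z (t + 1)) :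
    0 ≤ G.transProb t x p u x' p' z' := by
  refine Finset.sum_nonneg fun ws _ => Finset.sum_nonneg fun w _ => ?_
  dsimp only
  split_ifs
  · exact mul_nonneg ((G.lawWs t).2.1 ws) (Finset.prod_nonneg fun i _ =>
      Finset.prod_nonneg fun j _ => (G.lawWo (t + 1) i j).2.1 (w i j))
  · exact le_rfl

/-- Normalization of a nonnegative nonzero vector to a probability distribution. -/
def normalize {A : Type} [Fintype A] (v : A → ℝ) (hv : ∀ a, 0 ≤ v a) (hs : 0 < ∑ a, v a) :
    stdSimplex ℝ A :=
  ⟨fun a => v a / ∑ b, v b, fun a => div_nonneg (hv a) hs.le, by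
    rw [← Finset.sum_div, div_self hs.ne']⟩

/-- `ℙ[z₀]`, the law of the initial common information. -/
def initCommonProb (z : G.Z 0) : ℝ := ∑ s : G.X 0 × G.Priv 0, G.initProb s.1 s.2 z

/-- The initial common information belief: the conditional law of the initial state and private
information, given a realization of positive probability of the initial common information. -/
def initBelief (z : G.Z 0) (hz : 0 < G.initCommonProb z) : G.Belief 0 :=
  normalize (fun s => G.initProb s.1 s.2 z) (fun s => G.initProb_nonneg s.1 s.2 z) hz

/-- The expectation of a function of the initial common information belief. -/
def expectInit (φ : G.Belief 0 → ℝ) : ℝ :=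
  open Classical in
  ∑ z : {z : G.Z 0 // 0 < G.initCommonProb z}, G.initCommonProb z.1 * φ (G.initBelief z.1 z.2)

variable {G}

/-- The joint probability of the next common observation, state and private information, when the
current state and private information have the law `π` and the prescriptions are `γ₁`, `γ₂`. -/
def jointProb {t : ℕ} (π : G.Belief t) (γ₁ : G.Presc t 0) (γ₂ : G.Presc t 1)
    (z' : G.Z (t + 1)) (s' : G.X (t + 1) × G.Priv (t + 1)) : ℝ :=
  ∑ s : G.X t × G.Priv t, ∑ u : G.Act t,
    π s * actProb γ₁ (s.2 0) (u 0) * actProb γ₂ (s.2 1) (u 1) *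
      G.transProb t s.1 s.2 u s'.1 s'.2 z'

/-- The probability of the next common observation. -/
def commonProb {t : ℕ} (π : G.Belief t) (γ₁ : G.Presc t 0) (γ₂ : G.Presc t 1)
    (z' : G.Z (t + 1)) : ℝ :=
  ∑ s' : G.X (t + 1) × G.Priv (t + 1), jointProb π γ₁ γ₂ z' s'

lemma jointProb_nonneg {t : ℕ} (π : G.Belief t) (γ₁ : G.Presc t 0) (γ₂ : G.Presc t 1)
    (z' : G.Z (t + 1)) (s' : G.X (t + 1) × G.Priv (t + 1)) : 0 ≤ jointProb π γ₁ γ₂ z' s' :=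
  Finset.sum_nonneg fun s _ => Finset.sum_nonneg fun _ _ =>
    mul_nonneg (mul_nonneg (mul_nonneg (π.2.1 s) (G.actProb_nonneg _ _ _))
      (G.actProb_nonneg _ _ _)) (G.transProb_nonneg _ _ _ _ _ _ _)

variable (G) in
/-- An arbitrary choice of the updated belief after common observations of probability zero. -/
abbrev Fallback : Type :=
  ∀ t, G.Belief t → G.Presc t 0 → G.Presc t 1 → G.Z (t + 1) → G.Belief (t + 1)

open Classical in
/-- The update rule of the common information belief. -/
def update (D : G.Fallback) {t : ℕ} (π : G.Belief t) (γ₁ : G.Presc t 0) (γ₂ : G.Presc t 1)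
    (z' : G.Z (t + 1)) : G.Belief (t + 1) :=
  if hz : 0 < commonProb π γ₁ γ₂ z' then
    normalize (jointProb π γ₁ γ₂ z') (jointProb_nonneg π γ₁ γ₂ z') hz
  else D t π γ₁ γ₂ z'

/-- The expected cost at time `t` as a function of the belief and the prescriptions. -/
def stageCost {t : ℕ} (π : G.Belief t) (γ₁ : G.Presc t 0) (γ₂ : G.Presc t 1) : ℝ :=
  ∑ s : G.X t × G.Priv t, ∑ u : G.Act t,
    G.c t s.1 u * π s * actProb γ₁ (s.2 0) (u 0) * actProb γ₂ (s.2 1) (u 1)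

/-- The expected cost at time `t` plus the expectation of the function `V` of the next belief. -/
def costToGo (D : G.Fallback) {t : ℕ} (V : G.Belief (t + 1) → ℝ) (π : G.Belief t)
    (γ₁ : G.Presc t 0) (γ₂ : G.Presc t 1) : ℝ :=
  stageCost π γ₁ γ₂ + ∑ z' : G.Z (t + 1), commonProb π γ₁ γ₂ z' * V (update D π γ₁ γ₂ z')

/-- The upper value functions of the min-max dynamic program. -/
def upperV (D : G.Fallback) (t : ℕ) (π : G.Belief t) : ℝ :=
  if t < G.T then
    ⨅ γ₁ : G.Presc t 0, ⨆ γ₂ : G.Presc t 1, costToGo D (upperV D (t + 1)) π γ₁ γ₂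
  else 0
termination_by G.T - t

/-- The lower value functions of the max-min dynamic program. -/
def lowerV (D : G.Fallback) (t : ℕ) (π : G.Belief t) : ℝ :=
  if t < G.T then
    ⨆ γ₂ : G.Presc t 1, ⨅ γ₁ : G.Presc t 0, costToGo D (lowerV D (t + 1)) π γ₁ γ₂
  else 0
termination_by G.T - t

/-- The upper cost-to-go functions. -/
def upperW (D : G.Fallback) (t : ℕ) (π : G.Belief t) (γ₁ : G.Presc t 0) (γ₂ : G.Presc t 1) : ℝ :=
  costToGo D (upperV D (t + 1)) π γ₁ γ₂

/-- The lower cost-to-go functions. -/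
def lowerW (D : G.Fallback) (t : ℕ) (π : G.Belief t) (γ₁ : G.Presc t 0) (γ₂ : G.Presc t 1) : ℝ :=
  costToGo D (lowerV D (t + 1)) π γ₁ γ₂

end TeamGame

/-- `v` is the minimum over `a` of the maximum over `b` of `φ a b`, and all these are attained. -/
def IsMinMax {A B : Type} (φ : A → B → ℝ) (v : ℝ) : Prop :=
  ∃ m : A → ℝ, (∀ a, IsGreatest (Set.range (φ a)) (m a)) ∧ IsLeast (Set.range m) v

/-- `v` is the maximum over `b` of the minimum over `a` of `φ a b`, and all these are attained. -/
def IsMaxMin {A B : Type} (φ : A → B → ℝ) (v : ℝ) : Prop :=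
  ∃ m : B → ℝ, (∀ b, IsLeast (Set.range fun a => φ a b) (m b)) ∧ IsGreatest (Set.range m) v

/-- `v` is the minimum over `a`, which is attained, of the supremum over `b` of `φ a b`. -/
def IsMinSup {A B : Type} (φ : A → B → ℝ) (v : ℝ) : Prop :=
  ∃ m : A → ℝ, (∀ a, IsLUB (Set.range (φ a)) (m a)) ∧ IsLeast (Set.range m) v

/-- `v` is the maximum over `b`, which is attained, of the infimum over `a` of `φ a b`. -/
def IsMaxInf {A B : Type} (φ : A → B → ℝ) (v : ℝ) : Prop :=
  ∃ m : B → ℝ, (∀ b, IsGLB (Set.range fun a => φ a b) (m b)) ∧ IsGreatest (Set.range m) v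

end

/-! The Bayes update divides by the probability of the new common observation, so it is
discontinuous where that probability vanishes and arbitrary beyond. The proof removes the division
by working with unnormalized beliefs, which are arbitrary real vectors. There the update
`massUpdate` is linear in the mass and polynomial in the prescriptions. The value functions become
the positively homogeneous functions `upperMassV` and `lowerMassV`, since multiplying the value of a
normalized belief by the probability of the observation gives the value of the unnormalized one
(`costToGo_eq_massToGo`). Observations of probability zero give the zero vector, whose value is
zero, so the fallback plays no role. Backward induction shows that these functions are continuous.
Prescriptions form a compact space, so all minima and maxima in the dynamic programs are attained.

For the game values, the total cost is computed from the cost-to-go of a play (`expectedCost_eq`).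
Integrated against the unnormalized belief `infoMass`, this cost-to-go obeys the same one-step
recursion as the dynamic program (`sum_mul_playCost`). The belief `infoMass` depends only on the
information shared by the virtual players, so each of them can play an optimizer of the dynamic
program at the current mass. Stagewise inequalities then propagate to the total cost
(`expectedCost_le`, `le_expectedCost`): the outer player guarantees the value, and a stagewise best
response to any fixed strategy shows that nothing better is possible. -/

noncomputable section

/-! ### Extrema of continuous functions over compact spaces -/

section Extrema

variable {M A : Type*} [TopologicalSpace M] [TopologicalSpace A] [CompactSpace A]

lemma continuous_iSup_of_compactSpace {f : M → A → ℝ} (hf : Continuous ↿f) :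
    Continuous fun x => ⨆ a, f x a := by
  have h := isCompact_univ.continuous_sSup (K := (Set.univ : Set A)) hf
  simpa only [Set.image_univ, sSup_range] using h

lemma continuous_iInf_of_compactSpace {f : M → A → ℝ} (hf : Continuous ↿f) :
    Continuous fun x => ⨅ a, f x a := by
  have h := isCompact_univ.continuous_sInf (K := (Set.univ : Set A)) hf
  simpa only [Set.image_univ, sInf_range] using h

lemma isGreatest_iSup_of_continuous [Nonempty A] {f : A → ℝ} (hf : Continuous f) :
    IsGreatest (Set.range f) (⨆ a, f a) :=
  (isCompact_range hf).isGreatest_sSup (Set.range_nonempty f)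

lemma isLeast_iInf_of_continuous [Nonempty A] {f : A → ℝ} (hf : Continuous f) :
    IsLeast (Set.range f) (⨅ a, f a) :=
  (isCompact_range hf).isLeast_sInf (Set.range_nonempty f)

end Extrema

section MinMax

variable {A B : Type} [TopologicalSpace A] [TopologicalSpace B] [CompactSpace A] [CompactSpace B]
  [Nonempty A] [Nonempty B]

lemma isMinMax_of_continuous {φ : A → B → ℝ} (hφ : Continuous ↿φ) :
    IsMinMax φ (⨅ a, ⨆ b, φ a b) :=
  ⟨fun a => ⨆ b, φ a b,
    fun a => isGreatest_iSup_of_continuous (hφ.comp (Continuous.prodMk_right a)),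
    isLeast_iInf_of_continuous (continuous_iSup_of_compactSpace hφ)⟩

lemma isMaxMin_of_continuous {φ : A → B → ℝ} (hφ : Continuous ↿φ) :
    IsMaxMin φ (⨆ b, ⨅ a, φ a b) :=
  ⟨fun b => ⨅ a, φ a b,
    fun b => isLeast_iInf_of_continuous (hφ.comp (Continuous.prodMk_left b)),
    isGreatest_iSup_of_continuous
      (continuous_iInf_of_compactSpace (f := fun b a => φ a b) (hφ.comp continuous_swap))⟩

end MinMax

/-- A saddle-type certificate: `v` is guaranteed by `a₀` and cannot be undercut by any `a`. -/
lemma isMinSup_of_forall_exists {A B : Type} [Nonempty B] {φ : A → B → ℝ} {v : ℝ}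
    (hb : ∀ a, BddAbove (Set.range (φ a))) (h₁ : ∃ a, ∀ b, φ a b ≤ v)
    (h₂ : ∀ a, ∃ b, v ≤ φ a b) : IsMinSup φ v ∧ ⨅ a, ⨆ b, φ a b = v := by
  have hv : IsLeast (Set.range fun a => ⨆ b, φ a b) v := by
    have hle : ∀ a, v ≤ ⨆ b, φ a b := fun a =>
      let ⟨b, h⟩ := h₂ a
      h.trans (le_ciSup (hb a) b)
    obtain ⟨a, ha⟩ := h₁
    exact ⟨⟨a, (ciSup_le ha).antisymm (hle a)⟩, Set.forall_mem_range.2 hle⟩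
  exact ⟨⟨_, fun a => isLUB_ciSup (hb a), hv⟩, hv.csInf_eq⟩

lemma isMaxInf_of_forall_exists {A B : Type} [Nonempty A] {φ : A → B → ℝ} {v : ℝ}
    (hb : ∀ b, BddBelow (Set.range fun a => φ a b)) (h₁ : ∃ b, ∀ a, v ≤ φ a b)
    (h₂ : ∀ b, ∃ a, φ a b ≤ v) : IsMaxInf φ v ∧ ⨆ b, ⨅ a, φ a b = v := by
  have hv : IsGreatest (Set.range fun b => ⨅ a, φ a b) v := by
    have hle : ∀ b, ⨅ a, φ a b ≤ v := fun b =>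
      let ⟨a, h⟩ := h₂ b
      (ciInf_le (hb b) a).trans h
    obtain ⟨b, hb'⟩ := h₁
    exact ⟨⟨b, (hle b).antisymm (le_ciInf hb')⟩, Set.forall_mem_range.2 hle⟩
  exact ⟨⟨_, fun b => isGLB_ciInf (hb b), hv⟩, hv.csSup_eq⟩

/-- Matches the recursion of the value functions and of the cost-to-go, which terminates by `T - t`
and has its base case at every time from `T` on. -/
lemma backward_induction {T : ℕ} {Q : ℕ → Prop} (hT : ∀ t, ¬ t < T → Q t)
    (hs : ∀ t < T, Q (t + 1) → Q t) (t : ℕ) : Q t := by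
  induction h : T - t generalizing t with
  | zero => exact hT t (by omega)
  | succ n ih => exact hs t (by omega) (ih (t + 1) (by omega))

namespace TeamGame

variable {G : TeamGame}

instance (t : ℕ) (i : Fin 2) : Nonempty (G.Presc t i) :=
  ⟨fun _ _ => Classical.arbitrary _⟩

/-! ### Unnormalized beliefs -/

/-- Unnormalized beliefs, of any sign. -/
abbrev Mass (G : TeamGame) (t : ℕ) : Type := G.X t × G.Priv t → ℝ

/-- The stage cost, extended linearly to unnormalized beliefs. -/
def massCost {t : ℕ} (μ : G.Mass t) (γ₁ : G.Presc t 0) (γ₂ : G.Presc t 1) : ℝ :=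
  ∑ s : G.X t × G.Priv t, ∑ u : G.Act t,
    G.c t s.1 u * μ s * actProb γ₁ (s.2 0) (u 0) * actProb γ₂ (s.2 1) (u 1)

/-- The update of unnormalized beliefs. -/
def massUpdate {t : ℕ} (μ : G.Mass t) (γ₁ : G.Presc t 0) (γ₂ : G.Presc t 1)
    (z' : G.Z (t + 1)) : G.Mass (t + 1) := fun s' =>
  ∑ s : G.X t × G.Priv t, ∑ u : G.Act t,
    μ s * actProb γ₁ (s.2 0) (u 0) * actProb γ₂ (s.2 1) (u 1) *
      G.transProb t s.1 s.2 u s'.1 s'.2 z'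

/-- The cost-to-go on unnormalized beliefs. -/
def massToGo {t : ℕ} (V : G.Mass (t + 1) → ℝ) (μ : G.Mass t) (γ₁ : G.Presc t 0)
    (γ₂ : G.Presc t 1) : ℝ :=
  massCost μ γ₁ γ₂ + ∑ z' : G.Z (t + 1), V (massUpdate μ γ₁ γ₂ z')

/-- The positively homogeneous extension of `upperV`. -/
def upperMassV (t : ℕ) (μ : G.Mass t) : ℝ :=
  if t < G.T then ⨅ γ₁ : G.Presc t 0, ⨆ γ₂ : G.Presc t 1, massToGo (upperMassV (t + 1)) μ γ₁ γ₂
  else 0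
termination_by G.T - t

/-- The positively homogeneous extension of `lowerV`. -/
def lowerMassV (t : ℕ) (μ : G.Mass t) : ℝ :=
  if t < G.T then ⨆ γ₂ : G.Presc t 1, ⨅ γ₁ : G.Presc t 0, massToGo (lowerMassV (t + 1)) μ γ₁ γ₂
  else 0
termination_by G.T - t

lemma upperMassV_of_lt {t : ℕ} (ht : t < G.T) (μ : G.Mass t) :
    upperMassV t μ =
      ⨅ γ₁ : G.Presc t 0, ⨆ γ₂ : G.Presc t 1, massToGo (upperMassV (t + 1)) μ γ₁ γ₂ := by
  rw [upperMassV, if_pos ht]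

lemma upperMassV_of_not_lt {t : ℕ} (ht : ¬ t < G.T) (μ : G.Mass t) : upperMassV t μ = 0 := by
  rw [upperMassV, if_neg ht]

lemma lowerMassV_of_lt {t : ℕ} (ht : t < G.T) (μ : G.Mass t) :
    lowerMassV t μ =
      ⨆ γ₂ : G.Presc t 1, ⨅ γ₁ : G.Presc t 0, massToGo (lowerMassV (t + 1)) μ γ₁ γ₂ := by
  rw [lowerMassV, if_pos ht]

lemma lowerMassV_of_not_lt {t : ℕ} (ht : ¬ t < G.T) (μ : G.Mass t) : lowerMassV t μ = 0 := by
  rw [lowerMassV, if_neg ht]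

/-! Continuity. -/

lemma continuous_actProb {t : ℕ} {i : Fin 2} (p : ∀ j, G.P t i j) (u : ∀ j, G.U t i j) :
    Continuous fun γ : G.Presc t i => actProb γ p u :=
  continuous_finsetProd _ fun j _ => (continuous_apply (u j)).comp
    (continuous_subtype_val.comp ((continuous_apply (p j)).comp (continuous_apply j)))

lemma continuous_massCost (t : ℕ) :
    Continuous fun q : G.Mass t × G.Presc t 0 × G.Presc t 1 => massCost q.1 q.2.1 q.2.2 :=
  continuous_finsetSum _ fun s _ => continuous_finsetSum _ fun u _ =>
    ((continuous_const.mul ((continuous_apply s).comp continuous_fst)).mul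
      ((continuous_actProb (s.2 0) (u 0)).comp (continuous_fst.comp continuous_snd))).mul
      ((continuous_actProb (s.2 1) (u 1)).comp (continuous_snd.comp continuous_snd))

lemma continuous_massUpdate (t : ℕ) (z' : G.Z (t + 1)) :
    Continuous fun q : G.Mass t × G.Presc t 0 × G.Presc t 1 =>
      massUpdate q.1 q.2.1 q.2.2 z' :=
  continuous_pi fun _ => continuous_finsetSum _ fun s _ => continuous_finsetSum _ fun u _ =>
    ((((continuous_apply s).comp continuous_fst).mul
      ((continuous_actProb (s.2 0) (u 0)).comp (continuous_fst.comp continuous_snd))).mul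
      ((continuous_actProb (s.2 1) (u 1)).comp (continuous_snd.comp continuous_snd))).mul
      continuous_const

lemma continuous_massToGo {t : ℕ} {V : G.Mass (t + 1) → ℝ} (hV : Continuous V) :
    Continuous fun q : G.Mass t × G.Presc t 0 × G.Presc t 1 => massToGo V q.1 q.2.1 q.2.2 :=
  (continuous_massCost t).add
    (continuous_finsetSum _ fun z' _ => hV.comp (continuous_massUpdate t z'))

lemma continuous_massToGo_right {t : ℕ} {V : G.Mass (t + 1) → ℝ} (hV : Continuous V)
    (μ : G.Mass t) : Continuous ↿(massToGo V μ) :=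
  (continuous_massToGo hV).comp (Continuous.prodMk_right μ)

/-- No division occurs in `massToGo`, so continuity at time `t + 1` passes to it jointly in the mass
and both prescriptions. An extremum over a compact space preserves joint continuity in the remaining
variables. -/
lemma continuous_upperMassV (t : ℕ) : Continuous (upperMassV (G := G) t) := by
  refine backward_induction (T := G.T) (Q := fun t => Continuous (upperMassV (G := G) t))
    (fun t ht => ?_) (fun t ht ih => ?_) t
  · simpa only [funext (upperMassV_of_not_lt ht)] using continuous_const
  · rw [funext (upperMassV_of_lt ht)]
    refine continuous_iInf_of_compactSpace
      (f := fun μ γ₁ => ⨆ γ₂, massToGo (upperMassV (t + 1)) μ γ₁ γ₂) ?_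
    exact continuous_iSup_of_compactSpace
      (f := fun (q : G.Mass t × G.Presc t 0) γ₂ => massToGo (upperMassV (t + 1)) q.1 q.2 γ₂)
      ((continuous_massToGo ih).comp (Homeomorph.prodAssoc _ _ _).continuous)

lemma continuous_lowerMassV (t : ℕ) : Continuous (lowerMassV (G := G) t) := by
  refine backward_induction (T := G.T) (Q := fun t => Continuous (lowerMassV (G := G) t))
    (fun t ht => ?_) (fun t ht ih => ?_) t
  · simpa only [funext (lowerMassV_of_not_lt ht)] using continuous_const
  · rw [funext (lowerMassV_of_lt ht)]
    refine continuous_iSup_of_compactSpace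
      (f := fun μ γ₂ => ⨅ γ₁, massToGo (lowerMassV (t + 1)) μ γ₁ γ₂) ?_
    refine continuous_iInf_of_compactSpace
      (f := fun (q : G.Mass t × G.Presc t 1) γ₁ => massToGo (lowerMassV (t + 1)) q.1 γ₁ q.2) ?_
    exact (continuous_massToGo ih).comp
      ((continuous_fst.comp continuous_fst).prodMk
        (continuous_snd.prodMk (continuous_snd.comp continuous_fst)))

/-! Positive homogeneity. -/

lemma massCost_smul {t : ℕ} (r : ℝ) (μ : G.Mass t) (γ₁ : G.Presc t 0) (γ₂ : G.Presc t 1) :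
    massCost (r • μ) γ₁ γ₂ = r * massCost μ γ₁ γ₂ := by
  simp only [massCost, Finset.mul_sum, Pi.smul_apply, smul_eq_mul]
  exact Finset.sum_congr rfl fun s _ => Finset.sum_congr rfl fun u _ => by ring

lemma massUpdate_smul {t : ℕ} (r : ℝ) (μ : G.Mass t) (γ₁ : G.Presc t 0) (γ₂ : G.Presc t 1)
    (z' : G.Z (t + 1)) : massUpdate (r • μ) γ₁ γ₂ z' = r • massUpdate μ γ₁ γ₂ z' := by
  ext s'
  simp only [massUpdate, Finset.mul_sum, Pi.smul_apply, smul_eq_mul]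
  exact Finset.sum_congr rfl fun s _ => Finset.sum_congr rfl fun u _ => by ring

lemma massToGo_smul {t : ℕ} {V : G.Mass (t + 1) → ℝ} {r : ℝ}
    (hV : ∀ μ, V (r • μ) = r * V μ) (μ : G.Mass t) (γ₁ : G.Presc t 0) (γ₂ : G.Presc t 1) :
    massToGo V (r • μ) γ₁ γ₂ = r * massToGo V μ γ₁ γ₂ := by
  simp only [massToGo, massCost_smul, massUpdate_smul, hV, mul_add, Finset.mul_sum]

/-- Cost and update are linear in the mass, and a nonnegative factor passes through infima and
suprema. -/
lemma upperMassV_smul {r : ℝ} (hr : 0 ≤ r) (t : ℕ) (μ : G.Mass t) :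
    upperMassV t (r • μ) = r * upperMassV t μ := by
  refine backward_induction (T := G.T)
    (Q := fun t => ∀ μ : G.Mass t, upperMassV t (r • μ) = r * upperMassV t μ)
    (fun t ht μ => ?_) (fun t ht ih μ => ?_) t μ
  · simp only [upperMassV_of_not_lt ht, mul_zero]
  · simp only [upperMassV_of_lt ht, massToGo_smul ih, Real.mul_iInf_of_nonneg hr,
      Real.mul_iSup_of_nonneg hr]

lemma lowerMassV_smul {r : ℝ} (hr : 0 ≤ r) (t : ℕ) (μ : G.Mass t) :
    lowerMassV t (r • μ) = r * lowerMassV t μ := by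
  refine backward_induction (T := G.T)
    (Q := fun t => ∀ μ : G.Mass t, lowerMassV t (r • μ) = r * lowerMassV t μ)
    (fun t ht μ => ?_) (fun t ht ih μ => ?_) t μ
  · simp only [lowerMassV_of_not_lt ht, mul_zero]
  · simp only [lowerMassV_of_lt ht, massToGo_smul ih, Real.mul_iInf_of_nonneg hr,
      Real.mul_iSup_of_nonneg hr]

/-! Restriction to beliefs. -/

lemma sum_smul_normalize {A : Type} [Fintype A] (v : A → ℝ) (hv : ∀ a, 0 ≤ v a)
    (hs : 0 < ∑ a, v a) : (∑ a, v a) • ⇑(normalize v hv hs) = v := by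
  ext a
  exact mul_div_cancel₀ (v a) hs.ne'

/-- Homogeneity moves the probability of the observation inside `V`, where it cancels the
normalization. If this probability is zero, the nonnegative joint probabilities all vanish and both
terms are zero, whatever `D` is. -/
lemma costToGo_eq_massToGo (D : G.Fallback) {t : ℕ} {V : G.Mass (t + 1) → ℝ}
    (hV : ∀ r : ℝ, 0 ≤ r → ∀ μ, V (r • μ) = r * V μ) (π : G.Belief t) (γ₁ : G.Presc t 0)
    (γ₂ : G.Presc t 1) :
    costToGo D (fun π' => V π') π γ₁ γ₂ = massToGo V π γ₁ γ₂ := by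
  refine congrArg (stageCost π γ₁ γ₂ + ·) (Finset.sum_congr rfl fun z' _ => ?_)
  -- On a belief, `massUpdate` is `jointProb` by definition.
  change _ = V (jointProb π γ₁ γ₂ z')
  by_cases hz : 0 < commonProb π γ₁ γ₂ z'
  · rw [← hV _ hz.le, update, dif_pos hz]
    exact congrArg V (sum_smul_normalize _ _ hz)
  · have h0 : commonProb π γ₁ γ₂ z' = 0 :=
      le_antisymm (not_lt.1 hz) (Finset.sum_nonneg fun s' _ => jointProb_nonneg π γ₁ γ₂ z' s')
    have hj : jointProb π γ₁ γ₂ z' = 0 := funext fun s' =>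
      (Finset.sum_eq_zero_iff_of_nonneg fun s' _ => jointProb_nonneg π γ₁ γ₂ z' s').1 h0 s'
        (Finset.mem_univ s')
    have hV0 : V 0 = 0 := by simpa using hV 0 le_rfl 0
    rw [h0, hj, hV0, zero_mul]

lemma upperV_eq_upperMassV (D : G.Fallback) (t : ℕ) :
    upperV D t = fun π : G.Belief t => upperMassV t π := by
  refine backward_induction (T := G.T)
    (Q := fun t => upperV D t = fun π : G.Belief t => upperMassV t π)
    (fun t ht => ?_) (fun t ht ih => ?_) t
  · ext π
    rw [upperV, if_neg ht, upperMassV_of_not_lt ht]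
  · ext π
    rw [upperV, if_pos ht, upperMassV_of_lt ht, ih]
    simp only [costToGo_eq_massToGo D fun r hr => upperMassV_smul hr (t + 1)]

lemma lowerV_eq_lowerMassV (D : G.Fallback) (t : ℕ) :
    lowerV D t = fun π : G.Belief t => lowerMassV t π := by
  refine backward_induction (T := G.T)
    (Q := fun t => lowerV D t = fun π : G.Belief t => lowerMassV t π)
    (fun t ht => ?_) (fun t ht ih => ?_) t
  · ext π
    rw [lowerV, if_neg ht, lowerMassV_of_not_lt ht]
  · ext π
    rw [lowerV, if_pos ht, lowerMassV_of_lt ht, ih]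
    simp only [costToGo_eq_massToGo D fun r hr => lowerMassV_smul hr (t + 1)]

lemma upperW_eq_massToGo (D : G.Fallback) (t : ℕ) (π : G.Belief t) :
    upperW D t π = massToGo (upperMassV (t + 1)) π := by
  ext γ₁ γ₂
  rw [upperW, upperV_eq_upperMassV]
  exact costToGo_eq_massToGo D (fun r hr => upperMassV_smul hr (t + 1)) π γ₁ γ₂

lemma lowerW_eq_massToGo (D : G.Fallback) (t : ℕ) (π : G.Belief t) :
    lowerW D t π = massToGo (lowerMassV (t + 1)) π := by
  ext γ₁ γ₂
  rw [lowerW, lowerV_eq_lowerMassV]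
  exact costToGo_eq_massToGo D (fun r hr => lowerMassV_smul hr (t + 1)) π γ₁ γ₂

lemma isMinMax_upperW (D : G.Fallback) {t : ℕ} (ht : t < G.T) (π : G.Belief t) :
    IsMinMax (upperW D t π) (upperV D t π) := by
  simp only [upperW_eq_massToGo, upperV_eq_upperMassV, upperMassV_of_lt ht]
  exact isMinMax_of_continuous (continuous_massToGo_right (continuous_upperMassV _) _)

lemma isMaxMin_lowerW (D : G.Fallback) {t : ℕ} (ht : t < G.T) (π : G.Belief t) :
    IsMaxMin (lowerW D t π) (lowerV D t π) := by
  simp only [lowerW_eq_massToGo, lowerV_eq_lowerMassV, lowerMassV_of_lt ht]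
  exact isMaxMin_of_continuous (continuous_massToGo_right (continuous_lowerMassV _) _)

/-- The same cancellation at the initial time. Realizations of probability zero may be added to the
sum because `V 0 = 0`. -/
lemma expectInit_of_smul {V : G.Mass 0 → ℝ} (hV : ∀ r : ℝ, 0 ≤ r → ∀ μ, V (r • μ) = r * V μ) :
    G.expectInit (fun π => V π) = ∑ z, V fun s => G.initProb s.1 s.2 z := by
  classical
  have hV0 : V 0 = 0 := by simpa using hV 0 le_rfl 0
  have key : ∀ z : {z : G.Z 0 // 0 < G.initCommonProb z},
      G.initCommonProb z.1 * V (G.initBelief z.1 z.2) = V fun s => G.initProb s.1 s.2 z.1 :=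
    fun z => by
      rw [← hV _ z.2.le]
      exact congrArg V (sum_smul_normalize _ _ z.2)
  rw [expectInit]
  simp only [key]
  rw [← Finset.sum_subtype {z | 0 < G.initCommonProb z} (fun z => by simp)
    fun z => V fun s => G.initProb s.1 s.2 z]
  refine Finset.sum_filter_of_ne fun z _ hz => ?_
  by_contra h
  have h0 : ∑ s : G.X 0 × G.Priv 0, G.initProb s.1 s.2 z = 0 :=
    le_antisymm (not_lt.1 h) (Finset.sum_nonneg fun s _ => G.initProb_nonneg s.1 s.2 z)
  have hm : (fun s : G.X 0 × G.Priv 0 => G.initProb s.1 s.2 z) = 0 := funext fun s =>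
    (Finset.sum_eq_zero_iff_of_nonneg fun s _ => G.initProb_nonneg s.1 s.2 z).1 h0 s
      (Finset.mem_univ s)
  exact hz (by rw [hm, hV0])

/-! ### Total masses -/

lemma sum_prod_prod_stdSimplex {ι : Type} [Fintype ι] [DecidableEq ι] {κ : ι → Type}
    [∀ i, Fintype (κ i)] [∀ i, DecidableEq (κ i)] {A : ∀ i, κ i → Type} [∀ i j, Fintype (A i j)]
    (μ : ∀ i j, stdSimplex ℝ (A i j)) :
    ∑ w : ∀ i j, A i j, ∏ i, ∏ j, μ i j (w i j) = 1 := by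
  have h₁ : ∀ i, ∑ v : ∀ j, A i j, ∏ j, μ i j (v j) = 1 := fun i => by
    rw [← Fintype.prod_sum fun j a => μ i j a]
    exact Finset.prod_eq_one fun j _ => (μ i j).2.2
  rw [← Fintype.prod_sum fun i (v : ∀ j, A i j) => ∏ j, μ i j (v j)]
  exact Finset.prod_eq_one fun i _ => h₁ i

lemma sum_actProb {t : ℕ} {i : Fin 2} (γ : G.Presc t i) (p : ∀ j, G.P t i j) :
    ∑ u : ∀ j, G.U t i j, actProb γ p u = 1 := by
  simp only [actProb]
  rw [← Fintype.prod_sum fun j a => γ j (p j) a]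
  exact Finset.prod_eq_one fun j _ => (γ j (p j)).2.2

lemma sum_actProb_mul_actProb {t : ℕ} (γ₁ : G.Presc t 0) (γ₂ : G.Presc t 1) (p : G.Priv t) :
    ∑ u : G.Act t, actProb γ₁ (p 0) (u 0) * actProb γ₂ (p 1) (u 1) = 1 := by
  rw [← (piFinTwoEquiv fun i => ∀ j, G.U t i j).symm.sum_comp, Fintype.sum_prod_type]
  simp only [piFinTwoEquiv_symm_apply, Fin.cons_zero, Fin.cons_one, ← Finset.mul_sum]
  rw [← Finset.sum_mul]
  exact (congrArg₂ (· * ·) (sum_actProb γ₁ (p 0)) (sum_actProb γ₂ (p 1))).trans (one_mul 1)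

lemma sum_transProb (t : ℕ) (x : G.X t) (p : G.Priv t) (u : G.Act t) :
    ∑ x', ∑ p', ∑ z', G.transProb t x p u x' p' z' = 1 := by
  classical
  have h : ∑ x', ∑ p', ∑ z', G.transProb t x p u x' p' z' =
      ∑ q : G.X (t + 1) × G.Priv (t + 1) × G.Z (t + 1),
        G.transProb t x p u q.1 q.2.1 q.2.2 := by
    simp only [Fintype.sum_prod_type]
  have h₁ : (∑ ws, G.lawWs t ws) * ∑ w : ∀ i j, G.Wo (t + 1) i j,
      ∏ i, ∏ j, G.lawWo (t + 1) i j (w i j) = 1 := by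
    rw [sum_prod_prod_stdSimplex, mul_one]
    exact (G.lawWs t).2.2
  rw [h, ← h₁, Finset.sum_mul_sum]
  simp only [transProb]
  rw [Finset.sum_comm]
  refine Finset.sum_congr rfl fun ws _ => ?_
  rw [Finset.sum_comm]
  refine Finset.sum_congr rfl fun w _ => ?_
  -- For fixed noise exactly one triple of next state, private and common information occurs;
  -- merging the three equations into one makes the sum a single indicator.
  simp only [← Prod.mk_inj, Prod.mk.eta]
  rw [Finset.sum_ite_eq, if_pos (Finset.mem_univ _)]

lemma transProb_le_one (t : ℕ) (x : G.X t) (p : G.Priv t) (u : G.Act t) (x' : G.X (t + 1))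
    (p' : G.Priv (t + 1)) (z' : G.Z (t + 1)) : G.transProb t x p u x' p' z' ≤ 1 := by
  have h := fun x' p' z' => G.transProb_nonneg t x p u x' p' z'
  rw [← sum_transProb t x p u]
  exact (Finset.single_le_sum (fun z' _ => h x' p' z') (Finset.mem_univ z')).trans
    ((Finset.single_le_sum (fun p' _ => Finset.sum_nonneg fun z' _ => h x' p' z')
      (Finset.mem_univ p')).trans
    (Finset.single_le_sum (fun x' _ => Finset.sum_nonneg fun p' _ =>
      Finset.sum_nonneg fun z' _ => h x' p' z') (Finset.mem_univ x')))

lemma actProb_le_one {t : ℕ} {i : Fin 2} (γ : G.Presc t i) (p : ∀ j, G.P t i j)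
    (u : ∀ j, G.U t i j) : actProb γ p u ≤ 1 :=
  Finset.prod_le_one (fun j _ => (γ j (p j)).2.1 (u j)) fun j _ => by
    rw [← (γ j (p j)).2.2]
    exact Finset.single_le_sum (fun a _ => (γ j (p j)).2.1 a) (Finset.mem_univ (u j))

/-! ### Bounds -/

lemma trajProb_nonneg (χ₁ : G.Strat 0) (χ₂ : G.Strat 1) :
    ∀ t (ω : G.Traj t), 0 ≤ G.trajProb χ₁ χ₂ t ω
  | 0, (x, p, z) => G.initProb_nonneg x p z
  | t + 1, (ω, _, _, _, _) =>
    mul_nonneg (mul_nonneg (trajProb_nonneg χ₁ χ₂ t ω)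
      (mul_nonneg (G.actProb_nonneg _ _ _) (G.actProb_nonneg _ _ _)))
      (G.transProb_nonneg _ _ _ _ _ _ _)

lemma sum_traj_succ (t : ℕ) (F : G.Traj (t + 1) → ℝ) :
    ∑ ω, F ω = ∑ ω : G.Traj t, ∑ u, ∑ x', ∑ p', ∑ z', F (ω, u, x', p', z') := by
  refine (Fintype.sum_prod_type
    (f := (F : G.Traj t × G.Act t × G.X (t + 1) × G.Priv (t + 1) × G.Z (t + 1) → ℝ))).trans ?_
  simp only [Fintype.sum_prod_type]

/-- Each step multiplies by factors at most one. The point is that the bound does not depend on the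
strategies. -/
lemma trajProb_le (χ₁ : G.Strat 0) (χ₂ : G.Strat 1) :
    ∀ t (ω : G.Traj t), G.trajProb χ₁ χ₂ t ω ≤
      ∑ q : G.X 0 × G.Priv 0 × G.Z 0, G.initProb q.1 q.2.1 q.2.2
  | 0, (x, p, z) => Finset.single_le_sum
      (f := fun q : G.X 0 × G.Priv 0 × G.Z 0 => G.initProb q.1 q.2.1 q.2.2)
      (fun q _ => G.initProb_nonneg _ _ _) (Finset.mem_univ (x, p, z))
  | t + 1, (ω, u, x', p', z') => by
    have h := trajProb_nonneg χ₁ χ₂ t ω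
    refine le_trans ?_ (trajProb_le χ₁ χ₂ t ω)
    refine (mul_le_of_le_one_right (mul_nonneg h (mul_nonneg (G.actProb_nonneg _ _ _)
      (G.actProb_nonneg _ _ _))) (transProb_le_one _ _ _ _ _ _ _)).trans ?_
    exact mul_le_of_le_one_right h
      (mul_le_one₀ (actProb_le_one _ _ _) (G.actProb_nonneg _ _ _) (actProb_le_one _ _ _))

/-- Makes the inner supremum and infimum of the game values genuine least upper and greatest lower
bounds. -/
lemma exists_abs_expectedCost_le (G : TeamGame) : ∃ C, ∀ χ₁ χ₂, |G.expectedCost χ₁ χ₂| ≤ C :=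
  ⟨∑ ω : G.Traj G.T, (∑ q : G.X 0 × G.Priv 0 × G.Z 0, G.initProb q.1 q.2.1 q.2.2) *
      |G.totalCost G.T ω|, fun χ₁ χ₂ =>
    (Finset.abs_sum_le_sum_abs _ _).trans (Finset.sum_le_sum fun ω _ => by
      rw [abs_mul, abs_of_nonneg (trajProb_nonneg χ₁ χ₂ G.T ω)]
      exact mul_le_mul_of_nonneg_right (trajProb_le χ₁ χ₂ G.T ω) (abs_nonneg _))⟩

/-! ### The cost-to-go along a play -/

/-- The expected cost from time `t` on, given the information of the virtual players, the state
and the private information at that time. -/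
def playCost (χ₁ : G.Strat 0) (χ₂ : G.Strat 1) (t : ℕ) (ι : G.Info t)
    (s : G.X t × G.Priv t) : ℝ :=
  if t < G.T then
    ∑ u : G.Act t, actProb (χ₁ t ι) (s.2 0) (u 0) * actProb (χ₂ t ι) (s.2 1) (u 1) *
      (G.c t s.1 u + ∑ x', ∑ p', ∑ z', G.transProb t s.1 s.2 u x' p' z' *
        playCost χ₁ χ₂ (t + 1) (ι, (χ₁ t ι, χ₂ t ι), z') (x', p'))
  else 0
termination_by G.T - t

lemma playCost_of_lt (χ₁ : G.Strat 0) (χ₂ : G.Strat 1) {t : ℕ} (ht : t < G.T) (ι : G.Info t)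
    (s : G.X t × G.Priv t) :
    playCost χ₁ χ₂ t ι s =
      ∑ u : G.Act t, actProb (χ₁ t ι) (s.2 0) (u 0) * actProb (χ₂ t ι) (s.2 1) (u 1) *
        (G.c t s.1 u + ∑ x', ∑ p', ∑ z', G.transProb t s.1 s.2 u x' p' z' *
          playCost χ₁ χ₂ (t + 1) (ι, (χ₁ t ι, χ₂ t ι), z') (x', p')) := by
  rw [playCost, if_pos ht]

lemma playCost_of_not_lt (χ₁ : G.Strat 0) (χ₂ : G.Strat 1) {t : ℕ} (ht : ¬ t < G.T)
    (ι : G.Info t) (s : G.X t × G.Priv t) : playCost χ₁ χ₂ t ι s = 0 := by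
  rw [playCost, if_neg ht]

/-- The cost paid so far plus the expected remaining cost is a martingale, so its expectation stays
at its initial value. At the horizon the remaining cost is zero and the expectation is the total
cost. -/
lemma sum_trajProb_mul_eq (χ₁ : G.Strat 0) (χ₂ : G.Strat 1) (t : ℕ) (ht : t ≤ G.T) :
    ∑ ω : G.Traj t, G.trajProb χ₁ χ₂ t ω * (G.totalCost t ω +
      playCost χ₁ χ₂ t (Traj.info G χ₁ χ₂ t ω) (Traj.state G t ω, Traj.priv G t ω)) =
    ∑ x, ∑ p, ∑ z, G.initProb x p z * playCost χ₁ χ₂ 0 z (x, p) := by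
  induction t with
  | zero =>
    change ∑ ω : G.X 0 × G.Priv 0 × G.Z 0, G.initProb ω.1 ω.2.1 ω.2.2 *
      (0 + playCost χ₁ χ₂ 0 ω.2.2 (ω.1, ω.2.1)) = _
    simp only [Fintype.sum_prod_type, zero_add]
  | succ t ih =>
    rw [← ih (by omega), sum_traj_succ]
    refine Finset.sum_congr rfl fun ω _ => ?_
    set ι := Traj.info G χ₁ χ₂ t ω with hι
    set x := Traj.state G t ω with hx
    set p := Traj.priv G t ω with hp
    have hu : ∀ u : G.Act t, ∑ x', ∑ p', ∑ z', G.trajProb χ₁ χ₂ t ω *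
          (actProb (χ₁ t ι) (p 0) (u 0) * actProb (χ₂ t ι) (p 1) (u 1)) *
            G.transProb t x p u x' p' z' * (G.totalCost t ω + G.c t x u +
              playCost χ₁ χ₂ (t + 1) (ι, (χ₁ t ι, χ₂ t ι), z') (x', p')) =
        G.trajProb χ₁ χ₂ t ω * G.totalCost t ω *
          (actProb (χ₁ t ι) (p 0) (u 0) * actProb (χ₂ t ι) (p 1) (u 1)) +
        G.trajProb χ₁ χ₂ t ω *
          (actProb (χ₁ t ι) (p 0) (u 0) * actProb (χ₂ t ι) (p 1) (u 1) *
            (G.c t x u + ∑ x', ∑ p', ∑ z', G.transProb t x p u x' p' z' *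
              playCost χ₁ χ₂ (t + 1) (ι, (χ₁ t ι, χ₂ t ι), z') (x', p'))) := fun u => by
      -- The costs up to and including time `t` do not depend on the next state and information, so
      -- there the transition probabilities sum to one.
      simp only [mul_assoc, ← Finset.mul_sum, mul_add, Finset.sum_add_distrib, ← Finset.sum_mul,
        sum_transProb]
      ring
    refine (Finset.sum_congr rfl fun u _ => hu u).trans ?_
    rw [Finset.sum_add_distrib, ← Finset.mul_sum, ← Finset.mul_sum,
      sum_actProb_mul_actProb, playCost_of_lt χ₁ χ₂ (by omega), mul_one, mul_add]

lemma expectedCost_eq (χ₁ : G.Strat 0) (χ₂ : G.Strat 1) :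
    G.expectedCost χ₁ χ₂ = ∑ z, ∑ s : G.X 0 × G.Priv 0,
      G.initProb s.1 s.2 z * playCost χ₁ χ₂ 0 z s := by
  have h := sum_trajProb_mul_eq χ₁ χ₂ G.T le_rfl
  simp only [playCost_of_not_lt χ₁ χ₂ (lt_irrefl G.T), add_zero] at h
  rw [expectedCost, h, Finset.sum_comm (s := (Finset.univ : Finset (G.Z 0)))]
  simp only [Fintype.sum_prod_type]

/-- Beliefs scaled by the probability of the common information. -/
def infoMass : ∀ t, G.Info t → G.Mass t
  | 0, z => fun s => G.initProb s.1 s.2 z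
  | t + 1, (ι, γ, z') => massUpdate (infoMass t ι) γ.1 γ.2 z'

lemma sum_sum_comm_sum_sum {A B C D : Type*} [Fintype A] [Fintype B] [Fintype C] [Fintype D]
    (F : A → B → C → D → ℝ) :
    ∑ a, ∑ b, ∑ c, ∑ d, F a b c d = ∑ c, ∑ d, ∑ a, ∑ b, F a b c d := by
  have h := Finset.sum_comm (s := (Finset.univ : Finset (A × B)))
    (t := (Finset.univ : Finset (C × D))) (f := fun x y => F x.1 x.2 y.1 y.2)
  simpa only [Fintype.sum_prod_type] using h

/-- The prescriptions depend on `ι` alone, not on the state and private information, so the mass can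
be pushed forward through `massUpdate`. This is the recursion of `massToGo` with `playCost` in place
of a value function. -/
lemma sum_mul_playCost (χ₁ : G.Strat 0) (χ₂ : G.Strat 1) {t : ℕ} (ht : t < G.T) (ι : G.Info t)
    (μ : G.Mass t) :
    ∑ s, μ s * playCost χ₁ χ₂ t ι s = massCost μ (χ₁ t ι) (χ₂ t ι) + ∑ z', ∑ s',
      massUpdate μ (χ₁ t ι) (χ₂ t ι) z' s' *
        playCost χ₁ χ₂ (t + 1) (ι, (χ₁ t ι, χ₂ t ι), z') s' := by
  have h : ∀ s u, ∑ x', ∑ p', ∑ z', μ s * (actProb (χ₁ t ι) (s.2 0) (u 0) *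
        actProb (χ₂ t ι) (s.2 1) (u 1) * (G.transProb t s.1 s.2 u x' p' z' *
          playCost χ₁ χ₂ (t + 1) (ι, (χ₁ t ι, χ₂ t ι), z') (x', p'))) =
      ∑ z', ∑ s' : G.X (t + 1) × G.Priv (t + 1), μ s * actProb (χ₁ t ι) (s.2 0) (u 0) *
        actProb (χ₂ t ι) (s.2 1) (u 1) * G.transProb t s.1 s.2 u s'.1 s'.2 z' *
          playCost χ₁ χ₂ (t + 1) (ι, (χ₁ t ι, χ₂ t ι), z') s' := fun s u => by
    rw [Finset.sum_comm (s := (Finset.univ : Finset (G.Z (t + 1)))), Fintype.sum_prod_type]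
    refine Finset.sum_congr rfl fun x' _ => Finset.sum_congr rfl fun p' _ =>
      Finset.sum_congr rfl fun z' _ => ?_
    ring
  simp only [playCost_of_lt χ₁ χ₂ ht, massCost, massUpdate, Finset.sum_mul, Finset.mul_sum,
    mul_add, Finset.sum_add_distrib, h]
  refine congrArg₂ (· + ·) ?_ ?_
  · exact Finset.sum_congr rfl fun s _ => Finset.sum_congr rfl fun u _ => by ring
  · exact sum_sum_comm_sum_sum _

/-! ### Optimal strategies -/

/-- Verification by backward induction: the mass `infoMass` at the successor information is by
definition the update of the current one, so the induction hypothesis bounds each term of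
`sum_mul_playCost`. -/
lemma sum_infoMass_mul_playCost_le {χ₁ : G.Strat 0} {χ₂ : G.Strat 1}
    {V : ∀ t, G.Mass t → ℝ} (hT : ∀ t, ¬ t < G.T → ∀ μ, V t μ = 0)
    (hV : ∀ t < G.T, ∀ ι, massToGo (V (t + 1)) (infoMass t ι) (χ₁ t ι) (χ₂ t ι) ≤
      V t (infoMass t ι)) (t : ℕ) (ι : G.Info t) :
    ∑ s, infoMass t ι s * playCost χ₁ χ₂ t ι s ≤ V t (infoMass t ι) := by
  refine backward_induction (T := G.T) (Q := fun t => ∀ ι : G.Info t,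
    ∑ s, infoMass t ι s * playCost χ₁ χ₂ t ι s ≤ V t (infoMass t ι))
    (fun t ht ι => ?_) (fun t ht ih ι => ?_) t ι
  · simp only [playCost_of_not_lt χ₁ χ₂ ht, mul_zero, Finset.sum_const_zero, hT t ht, le_refl]
  · rw [sum_mul_playCost χ₁ χ₂ ht]
    exact (add_le_add_right (Finset.sum_le_sum fun z' _ =>
      ih (ι, (χ₁ t ι, χ₂ t ι), z')) _).trans (hV t ht ι)

lemma le_sum_infoMass_mul_playCost {χ₁ : G.Strat 0} {χ₂ : G.Strat 1}
    {V : ∀ t, G.Mass t → ℝ} (hT : ∀ t, ¬ t < G.T → ∀ μ, V t μ = 0)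
    (hV : ∀ t < G.T, ∀ ι, V t (infoMass t ι) ≤
      massToGo (V (t + 1)) (infoMass t ι) (χ₁ t ι) (χ₂ t ι)) (t : ℕ) (ι : G.Info t) :
    V t (infoMass t ι) ≤ ∑ s, infoMass t ι s * playCost χ₁ χ₂ t ι s := by
  refine backward_induction (T := G.T) (Q := fun t => ∀ ι : G.Info t,
    V t (infoMass t ι) ≤ ∑ s, infoMass t ι s * playCost χ₁ χ₂ t ι s)
    (fun t ht ι => ?_) (fun t ht ih ι => ?_) t ι
  · simp only [playCost_of_not_lt χ₁ χ₂ ht, mul_zero, Finset.sum_const_zero, hT t ht, le_refl]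
  · rw [sum_mul_playCost χ₁ χ₂ ht]
    exact (hV t ht ι).trans (add_le_add_right (Finset.sum_le_sum fun z' _ =>
      ih (ι, (χ₁ t ι, χ₂ t ι), z')) _)

lemma expectedCost_le {χ₁ : G.Strat 0} {χ₂ : G.Strat 1}
    {V : ∀ t, G.Mass t → ℝ} (hT : ∀ t, ¬ t < G.T → ∀ μ, V t μ = 0)
    (hV : ∀ t < G.T, ∀ ι, massToGo (V (t + 1)) (infoMass t ι) (χ₁ t ι) (χ₂ t ι) ≤
      V t (infoMass t ι)) :
    G.expectedCost χ₁ χ₂ ≤ ∑ z, V 0 fun s => G.initProb s.1 s.2 z := by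
  rw [expectedCost_eq]
  exact Finset.sum_le_sum fun z _ => sum_infoMass_mul_playCost_le hT hV 0 z

lemma le_expectedCost {χ₁ : G.Strat 0} {χ₂ : G.Strat 1}
    {V : ∀ t, G.Mass t → ℝ} (hT : ∀ t, ¬ t < G.T → ∀ μ, V t μ = 0)
    (hV : ∀ t < G.T, ∀ ι, V t (infoMass t ι) ≤
      massToGo (V (t + 1)) (infoMass t ι) (χ₁ t ι) (χ₂ t ι)) :
    ∑ z, V 0 (fun s => G.initProb s.1 s.2 z) ≤ G.expectedCost χ₁ χ₂ := by
  rw [expectedCost_eq]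
  exact Finset.sum_le_sum fun z _ => le_sum_infoMass_mul_playCost hT hV 0 z

/-- The minimizer plays an optimal prescription at the current mass. Against a fixed `χ₁`, the
maximizer knows the prescription `χ₁ t ι` at the shared information `ι` and answers it optimally.
Arbitrary choices of optimizers suffice: the cost is a finite sum, so no measurability in the
information is needed. -/
lemma isMinSup_upperValue (D : G.Fallback) :
    IsMinSup G.expectedCost (G.expectInit (upperV D 0)) ∧
      G.upperValue = G.expectInit (upperV D 0) := by
  rw [upperV_eq_upperMassV, expectInit_of_smul fun r hr => upperMassV_smul hr 0]
  -- Stated for all `t`, also beyond the horizon, since a strategy must be defined at every time.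
  have hmm := fun t (μ : G.Mass t) =>
    isMinMax_of_continuous (continuous_massToGo_right (continuous_upperMassV (t + 1)) μ)
  choose m hm hl using hmm
  obtain ⟨C, hC⟩ := exists_abs_expectedCost_le G
  refine isMinSup_of_forall_exists (fun χ₁ => ⟨C, ?_⟩) ?_ fun χ₁ => ?_
  · exact Set.forall_mem_range.2 fun χ₂ => (abs_le.1 (hC χ₁ χ₂)).2
  -- `a t μ` attains the outer minimum at the mass `μ`.
  · choose a ha using fun t μ => (hl t μ).1
    refine ⟨fun t ι => a t (infoMass t ι), fun χ₂ =>
      expectedCost_le (fun t ht μ => upperMassV_of_not_lt ht μ) fun t ht ι => ?_⟩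
    rw [upperMassV_of_lt ht, ← ha]
    exact (hm t _ _).2 ⟨_, rfl⟩
  -- `b t μ γ₁` attains the inner maximum, a best response to `γ₁`.
  · choose b hb using fun t μ γ₁ => (hm t μ γ₁).1
    refine ⟨fun t ι => b t (infoMass t ι) (χ₁ t ι),
      le_expectedCost (fun t ht μ => upperMassV_of_not_lt ht μ) fun t ht ι => ?_⟩
    rw [upperMassV_of_lt ht, hb]
    exact (hl t _).2 ⟨_, rfl⟩

/-- Mirror image of `isMinSup_upperValue`: the maximizer commits first and the minimizer answers the
prescription `χ₂ t ι`. -/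
lemma isMaxInf_lowerValue (D : G.Fallback) :
    IsMaxInf G.expectedCost (G.expectInit (lowerV D 0)) ∧
      G.lowerValue = G.expectInit (lowerV D 0) := by
  rw [lowerV_eq_lowerMassV, expectInit_of_smul fun r hr => lowerMassV_smul hr 0]
  have hmm := fun t (μ : G.Mass t) =>
    isMaxMin_of_continuous (continuous_massToGo_right (continuous_lowerMassV (t + 1)) μ)
  choose m hm hl using hmm
  obtain ⟨C, hC⟩ := exists_abs_expectedCost_le G
  refine isMaxInf_of_forall_exists (fun χ₂ => ⟨-C, ?_⟩) ?_ fun χ₂ => ?_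
  · exact Set.forall_mem_range.2 fun χ₁ => (abs_le.1 (hC χ₁ χ₂)).1
  · choose b hb using fun t μ => (hl t μ).1
    refine ⟨fun t ι => b t (infoMass t ι), fun χ₁ =>
      le_expectedCost (fun t ht μ => lowerMassV_of_not_lt ht μ) fun t ht ι => ?_⟩
    rw [lowerMassV_of_lt ht, ← hb]
    exact (hm t _ _).2 ⟨_, rfl⟩
  · choose a ha using fun t μ γ₂ => (hm t μ γ₂).1
    refine ⟨fun t ι => a t (infoMass t ι) (χ₂ t ι),
      expectedCost_le (fun t ht μ => lowerMassV_of_not_lt ht μ) fun t ht ι => ?_⟩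
    rw [lowerMassV_of_lt ht]
    exact (ha t _ _).le.trans ((hl t _).2 ⟨_, rfl⟩)

end TeamGame
end

theorem theorem2 (G : TeamGame) (D : G.Fallback) :
    (∀ t < G.T, ∀ π : G.Belief t,
      IsMinMax (TeamGame.upperW D t π) (TeamGame.upperV D t π) ∧
      IsMaxMin (TeamGame.lowerW D t π) (TeamGame.lowerV D t π)) ∧
    IsMinSup G.expectedCost G.upperValue ∧
    IsMaxInf G.expectedCost G.lowerValue ∧
    G.upperValue = G.expectInit (TeamGame.upperV D 0) ∧
    G.lowerValue = G.expectInit (TeamGame.lowerV D 0) := by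
  obtain ⟨hu, hu'⟩ := TeamGame.isMinSup_upperValue D
  obtain ⟨hl, hl'⟩ := TeamGame.isMaxInf_lowerValue D
  exact ⟨fun t ht π => ⟨TeamGame.isMinMax_upperW D ht π, TeamGame.isMaxMin_lowerW D ht π⟩,
    hu' ▸ hu, hl' ▸ hl, hu', hl'⟩
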